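/- Let $\overline{H}$ denote the 2-edge-coloured graph obtained from a 2-edge-coloured (red/blue) graph $H$ by interchanging the two colours, and let $C_4$ denote the 2-edge-coloured $K_4$ whose red edges form a 4-cycle (the other two edges being blue). A 2-edge-coloured complete graph $K_n$ is called locally $\delta$-balanced if every vertex is incident to at least $\delta n$ red edges and to at least $\delta n$ blue edges. A copy of a 2-edge-coloured $K_4$ in a 2-edge-coloured $K_n$ is a set of four vertices on which the induced 2-edge-coloured complete graph is isomorphic to it by a colour-preserving bijection. There exists an absolute constant $C_1 > 0$ such that the following holds for every $\varepsilon > 0$ and every $n \neq 5$. Every locally $(1/4+\varepsilon)$-balanced 2-edge-coloured $K_n$ contains at least $2^{-C_1 (\log(1/\varepsilon))^8}\, n^4$ copies of $C_4$, or contains at least $2^{-C_1 (\log(1/\varepsilon))^8}\, n^4$ copies of $\overline{C_4}$. -/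

import Mathlib

namespace LocallyBalanced

open SimpleGraph

/-- An edge-coloured complete graph on `V` is locally `δ`-balanced if every vertex is incident to
at least `δ |V|` edges of each colour. -/
def IsLocallyBalanced {V K : Type*} [Fintype V] [DecidableEq V] [DecidableEq K]
    (c : TopEdgeLabeling V K) (δ : ℝ) : Prop :=
  ∀ (v : V) (k : K), δ * (Fintype.card V : ℝ) ≤ ((c.labelGraph k).degree v : ℝ)

/-- The copies, in an edge-coloured complete graph on `V`, of an edge-coloured complete graph `H`
on `W`. A copy is the image of a colour-preserving injection; as `H` is complete, it is determined
by its vertex set, so different injections with the same image count as one copy. -/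
def copies {V W K : Type*} [Fintype W]
    (H : TopEdgeLabeling W K) (c : TopEdgeLabeling V K) : Set (Finset V) :=
  {S | ∃ φ : W ↪ V, Finset.univ.map φ = S ∧ c.pullback φ = H}

/-- The 2-coloured `K₄` whose red edges (colour `1`) form a 4-cycle, the other two edges being
blue (colour `0`). -/
def C4 : TopEdgeLabeling (Fin 4) (Fin 2) :=
  EdgeLabeling.mk (fun i j _ => if i - j = 1 ∨ j - i = 1 then 1 else 0)
    (fun i j _ => by simp only [or_comm])

/-- Interchange the two colours. -/
def swapColours {V : Type*} (c : TopEdgeLabeling V (Fin 2)) : TopEdgeLabeling V (Fin 2) :=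
  c.compRight (Equiv.swap 0 1)

end LocallyBalanced

namespace LocallyBalanced

open SimpleGraph Finset

/-! The core is an exact statement, `exists_inducedSquare`. A graph with no induced 4-cycle in it or
in its complement is nearly split: a clique A and an independent set B, possibly with one extra
pentagon that is completely joined to A and not joined to B (`SquareFree.split_or_pentagon`,
`SquareFree.adj_pentagon`). The non-neighbours of A then all lie in B and the neighbours of B all
lie in A, so together they number |A||B| ≤ (|A| + |B|)²/4, and not every degree and codegree can
exceed n/4. The bare pentagon, where A and B are empty, is why n = 5 is excluded.

Sampling turns existence into counting. Among s of order ε⁻⁴ random vertices the degree conditions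
survive often enough that half of all samples contain a square, so there are at least n⁴/(2s⁴)
square 4-tuples (`card_squares_ge`). If n < 4s², a single copy suffices. The resulting bound is
polynomial in ε, which is stronger than required. -/

/-! ### Structure of square-free graphs. -/

/-- The vertices `a, b, c, d` induce, in this cyclic order, a 4-cycle of `G`. -/
def InducedSquare {V : Type*} (G : SimpleGraph V) (a b c d : V) : Prop :=
  G.Adj a b ∧ G.Adj b c ∧ G.Adj c d ∧ G.Adj d a ∧ Gᶜ.Adj a c ∧ Gᶜ.Adj b d

/-- Neither `G` nor its complement contains an induced 4-cycle. -/
def SquareFree {V : Type*} (G : SimpleGraph V) : Prop :=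
  ∀ a b c d, ¬ InducedSquare G a b c d ∧ ¬ InducedSquare Gᶜ a b c d

theorem SquareFree.no_square {V : Type*} {G : SimpleGraph V} (h : SquareFree G) {a b c d : V}
    (hab : G.Adj a b) (hbc : G.Adj b c) (hcd : G.Adj c d) (hda : G.Adj d a)
    (hac : a ≠ c) (hbd : b ≠ d) : G.Adj a c ∨ G.Adj b d := by
  by_contra hn
  push Not at hn
  exact (h a b c d).1 ⟨hab, hbc, hcd, hda, (compl_adj ..).2 ⟨hac, hn.1⟩,
    (compl_adj ..).2 ⟨hbd, hn.2⟩⟩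

/-- Two edges with nothing between them form the square a, c, b, d of the complement. -/
theorem SquareFree.no_matching {V : Type*} {G : SimpleGraph V} (h : SquareFree G) {a b c d : V}
    (hab : G.Adj a b) (hcd : G.Adj c d) (hac : a ≠ c) (had : a ≠ d) (hbc : b ≠ c) (hbd : b ≠ d) :
    G.Adj a c ∨ G.Adj a d ∨ G.Adj b c ∨ G.Adj b d := by
  by_contra hn
  push Not at hn
  obtain ⟨h1, h2, h3, h4⟩ := hn
  refine (h a c b d).2 ⟨(compl_adj ..).2 ⟨hac, h1⟩, (compl_adj ..).2 ⟨hbc.symm, fun e => h3 e.symm⟩,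
    (compl_adj ..).2 ⟨hbd, h4⟩, (compl_adj ..).2 ⟨had.symm, fun e => h2 e.symm⟩, ?_, ?_⟩ <;>
    simpa

open Classical in
/-- Degree counting across a pair `(A, B)` such that the vertices of `A` have all their
non-neighbours in `B`, and those of `B` have all their neighbours in `A`. -/
theorem exists_small_degree_of_split {V : Type*} [Fintype V] (G : SimpleGraph V)
    (A B : Finset V) (hAB : Disjoint A B) (hne : (A ∪ B).Nonempty)
    (hA : ∀ a ∈ A, ∀ v, v ≠ a → ¬ G.Adj a v → v ∈ B)
    (hB : ∀ b ∈ B, ∀ v, G.Adj b v → v ∈ A) :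
    ∃ v, 4 * #{u | G.Adj v u} ≤ Fintype.card V ∨ 4 * #{u | Gᶜ.Adj v u} ≤ Fintype.card V := by
  by_contra hcon
  push Not at hcon
  have h1 : ∀ a ∈ A, #{u | Gᶜ.Adj a u} ≤ #{b ∈ B | ¬ G.Adj a b} := by
    intro a ha
    apply card_le_card
    intro u hu
    simp only [mem_filter, mem_univ, true_and, compl_adj] at hu ⊢
    exact ⟨hA a ha u hu.1.symm hu.2, hu.2⟩
  have h2 : ∀ b ∈ B, #{u | G.Adj b u} ≤ #{a ∈ A | G.Adj a b} := by
    intro b hb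
    apply card_le_card
    intro u hu
    simp only [mem_filter, mem_univ, true_and] at hu ⊢
    exact ⟨hB b hb u hu, hu.symm⟩
  -- Each pair in A × B is counted once: as a non-edge from A or as an edge from B.
  have h3 : ∑ a ∈ A, #{b ∈ B | ¬ G.Adj a b} + ∑ b ∈ B, #{a ∈ A | G.Adj a b} = #A * #B := by
    have : ∑ b ∈ B, #{a ∈ A | G.Adj a b} = ∑ a ∈ A, #{b ∈ B | G.Adj a b} :=
      (sum_card_bipartiteAbove_eq_sum_card_bipartiteBelow G.Adj).symm
    rw [this, ← sum_add_distrib]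
    rw [← smul_eq_mul, ← sum_const]
    refine sum_congr rfl fun a _ => ?_
    rw [add_comm, card_filter_add_card_filter_not]
  have h4 : ∑ a ∈ A, (Fintype.card V + 1) ≤ ∑ a ∈ A, 4 * #{b ∈ B | ¬ G.Adj a b} :=
    sum_le_sum fun a ha => by have := h1 a ha; have := (hcon a).2; omega
  have h5 : ∑ b ∈ B, (Fintype.card V + 1) ≤ ∑ b ∈ B, 4 * #{a ∈ A | G.Adj a b} :=
    sum_le_sum fun b hb => by have := h2 b hb; have := (hcon b).1; omega
  rw [← mul_sum, sum_const, smul_eq_mul] at h4 h5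
  have h6 : #A + #B ≤ Fintype.card V := by
    rw [← card_union_of_disjoint hAB]; exact card_le_univ _
  have h7 : 0 < #A + #B := by rw [← card_union_of_disjoint hAB]; exact hne.card_pos
  zify at *
  -- 4|A||B| ≤ (|A| + |B|)² ≤ (|A| + |B|)n; vertices outside A ∪ B do no harm.
  nlinarith [sq_nonneg ((#A : ℤ) - #B)]

open Classical in
/-- A square-free graph without an induced 5-cycle is split; with one, the pentagon vertices
`x, y, u, z, w` are as listed. -/
theorem SquareFree.split_or_pentagon {V : Type*} [Fintype V] {G : SimpleGraph V}
    (h : SquareFree G) :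
    (∃ K : Finset V, (∀ a ∈ K, ∀ b ∈ K, a ≠ b → G.Adj a b) ∧ ∀ a ∉ K, ∀ b ∉ K, ¬ G.Adj a b) ∨
    ∃ x y u z w, G.Adj x y ∧ G.Adj y u ∧ G.Adj u z ∧ G.Adj z w ∧ G.Adj w x ∧
      Gᶜ.Adj x u ∧ Gᶜ.Adj y z ∧ Gᶜ.Adj u w ∧ Gᶜ.Adj z x ∧ Gᶜ.Adj w y := by
  set cl : Finset (Finset V) := {K | ∀ a ∈ K, ∀ b ∈ K, a ≠ b → G.Adj a b} with hcl
  have hmem : ∀ K, K ∈ cl ↔ ∀ a ∈ K, ∀ b ∈ K, a ≠ b → G.Adj a b := by simp [hcl]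
  -- K is a maximum clique with, among those, the fewest edges outside it. Maximality yields z and w
  -- below; minimality yields u.
  obtain ⟨K₀, hK₀, hK₀max⟩ := exists_max_image cl card ⟨∅, by simp [hmem]⟩
  let out : Finset V → ℕ := fun K => #{p : V × V | p.1 ∉ K ∧ p.2 ∉ K ∧ G.Adj p.1 p.2}
  obtain ⟨K, hK, hKmin⟩ := exists_min_image {K ∈ cl | #K = #K₀} out ⟨K₀, by simp [hK₀]⟩
  simp only [mem_filter] at hK hKmin
  obtain ⟨hKcl, hKcard⟩ := hK
  have hmax : ∀ L ∈ cl, #L ≤ #K := fun L hL => hKcard ▸ hK₀max L hL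
  have hKadj := (hmem K).1 hKcl
  by_cases hind : ∀ a ∉ K, ∀ b ∉ K, ¬ G.Adj a b
  · exact Or.inl ⟨K, hKadj, hind⟩
  right
  have main : ∀ x ∉ K, ∀ y ∉ K, G.Adj x y → (∀ a ∈ K, ¬ G.Adj x a → ¬ G.Adj y a) →
      ∃ x y u z w, G.Adj x y ∧ G.Adj y u ∧ G.Adj u z ∧ G.Adj z w ∧ G.Adj w x ∧
        Gᶜ.Adj x u ∧ Gᶜ.Adj y z ∧ Gᶜ.Adj u w ∧ Gᶜ.Adj z x ∧ Gᶜ.Adj w y := by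
    intro x hx y hy hxy hsub
    have hne : ∀ {a b}, a ∈ K → b ∉ K → a ≠ b := fun ha hb e => hb (e ▸ ha)
    obtain ⟨z, hz, hxz⟩ : ∃ z ∈ K, ¬ G.Adj x z := by
      by_contra hcon
      push Not at hcon
      have := hmax (insert x K) (by
        rw [hmem]; intro a ha b hb hab
        rw [mem_insert] at ha hb
        rcases ha with rfl | ha <;> rcases hb with rfl | hb
        · exact (hab rfl).elim
        · exact hcon b hb
        · exact (hcon a ha).symm
        · exact hKadj a ha b hb hab)
      rw [card_insert_of_notMem hx] at this
      omega
    have hyz := hsub z hz hxz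
    have hxuniq : ∀ a ∈ K, a ≠ z → G.Adj x a := by
      intro a ha haz
      by_contra hxa
      have := h.no_matching hxy (hKadj a ha z hz haz) (hne ha hx).symm (hne hz hx).symm
        (hne ha hy).symm (hne hz hy).symm
      have := hsub a ha hxa
      tauto
    obtain ⟨w, hw, hwz, hyw⟩ : ∃ w ∈ K, w ≠ z ∧ ¬ G.Adj y w := by
      by_contra hcon
      push Not at hcon
      have := hmax (insert x (insert y (K.erase z))) (by
        rw [hmem]; intro a ha b hb hab
        simp only [mem_insert, mem_erase] at ha hb
        rcases ha with rfl | rfl | ⟨haz, ha⟩ <;> rcases hb with rfl | rfl | ⟨hbz, hb⟩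
        · exact (hab rfl).elim
        · exact hxy
        · exact hxuniq b hb hbz
        · exact hxy.symm
        · exact (hab rfl).elim
        · exact hcon b hb hbz
        · exact (hxuniq a ha haz).symm
        · exact (hcon a ha haz).symm
        · exact hKadj a ha b hb hab)
      rw [card_insert_of_notMem (by simp [hxy.ne, hx]), card_insert_of_notMem (by simp [hy]),
        card_erase_of_mem hz] at this
      have := card_pos.2 ⟨z, hz⟩
      omega
    -- Otherwise exchanging z for x gives a maximum clique with fewer outside edges: the
    -- transposition of z and x maps its outside edges into those of K, missing (x, y) because y and
    -- z are not adjacent.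
    obtain ⟨u, hu, huz, hxu, hux⟩ : ∃ u ∉ K, G.Adj u z ∧ ¬ G.Adj x u ∧ u ≠ x := by
      by_contra hcon
      push Not at hcon
      have hK'cl : insert x (K.erase z) ∈ cl := by
        rw [hmem]; intro a ha b hb hab
        simp only [mem_insert, mem_erase] at ha hb
        rcases ha with rfl | ⟨haz, ha⟩ <;> rcases hb with rfl | ⟨hbz, hb⟩
        · exact (hab rfl).elim
        · exact hxuniq b hb hbz
        · exact (hxuniq a ha haz).symm
        · exact hKadj a ha b hb hab
      have hK'card : #(insert x (K.erase z)) = #K₀ := by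
        have := card_pos.2 ⟨z, hz⟩
        rw [card_insert_of_notMem (by simp [hx]), card_erase_of_mem hz]
        omega
      have hle := hKmin _ ⟨hK'cl, hK'card⟩
      have hzx := hne hz hx
      have hlt : out (insert x (K.erase z)) < out K := by
        have hyx := hxy.ne'
        let σ := Equiv.swap z x
        have himg : image (Prod.map σ σ)
            {p : V × V | p.1 ∉ insert x (K.erase z) ∧ p.2 ∉ insert x (K.erase z) ∧
              G.Adj p.1 p.2} ⊂ ({p : V × V | p.1 ∉ K ∧ p.2 ∉ K ∧ G.Adj p.1 p.2} : Finset _) := by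
          rw [ssubset_iff_of_subset]
          · refine ⟨(x, y), by simp [hx, hy, hxy], ?_⟩
            simp only [mem_image, mem_filter, mem_univ, true_and, Prod.exists, Prod.map_apply,
              Prod.mk.injEq, not_exists, not_and, and_imp]
            intro a b _ _ hab h1 h2
            have ha : a = z := by
              rw [← Equiv.symm_apply_apply σ a, h1]; simp [σ]
            have hb : b = y := by
              rw [← Equiv.symm_apply_apply σ b, h2]
              simpa [σ] using Equiv.swap_apply_of_ne_of_ne (hne hz hy).symm hyx
            exact hyz (ha ▸ hb ▸ hab.symm)
          · intro q hq
            simp only [mem_image, mem_filter, mem_univ, true_and, Prod.exists] at hq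
            obtain ⟨a, b, ⟨ha, hb, hab⟩, rfl⟩ := hq
            have fixed : ∀ v, v ∉ insert x (K.erase z) → v ≠ z → σ v = v ∧ v ∉ K ∧ v ≠ x := by
              intro v hv hvz
              simp only [mem_insert, mem_erase, not_or, not_and] at hv
              exact ⟨Equiv.swap_apply_of_ne_of_ne hvz hv.1, fun hvK => hvz (by tauto), hv.1⟩
            have hσz : σ z = x := Equiv.swap_apply_left z x
            simp only [mem_filter, mem_univ, true_and, Prod.map_apply]
            by_cases haz : a = z
            · subst haz
              obtain ⟨e, hbK, hbx⟩ := fixed b hb hab.ne'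
              rw [hσz, e]
              refine ⟨hx, hbK, ?_⟩
              by_contra hn
              exact hbx (hcon b hbK hab.symm hn)
            · obtain ⟨e, haK, hax⟩ := fixed a ha haz
              rw [e]
              by_cases hbz : b = z
              · subst hbz
                rw [hσz]
                refine ⟨haK, hx, ?_⟩
                by_contra hn
                exact hax (hcon a haK hab fun t => hn t.symm)
              · obtain ⟨e', hbK, hbx⟩ := fixed b hb hbz
                rw [e']
                exact ⟨haK, hbK, hab⟩
        have := card_lt_card himg
        rwa [card_image_of_injective _ (σ.injective.prodMap σ.injective)] at this
      omega
    have huy : u ≠ y := fun e => hxu (e ▸ hxy)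
    have hyu : G.Adj y u := by
      have := h.no_matching hxy huz hux.symm (hne hz hx).symm huy.symm (hne hz hy).symm
      tauto
    have hwx := hxuniq w hw hwz
    have huw : ¬ G.Adj u w := fun huw => by
      have := h.no_square hxy hyu huw hwx.symm hux.symm (hne hw hy).symm
      tauto
    exact ⟨x, y, u, z, w, hxy, hyu, huz, hKadj z hz w hw hwz.symm, hwx.symm,
      (compl_adj ..).2 ⟨hux.symm, hxu⟩, (compl_adj ..).2 ⟨(hne hz hy).symm, hyz⟩,
      (compl_adj ..).2 ⟨(hne hw hu).symm, huw⟩,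
      (compl_adj ..).2 ⟨hne hz hx, fun t => hxz t.symm⟩,
      (compl_adj ..).2 ⟨hne hw hy, fun t => hyw t.symm⟩⟩
  push Not at hind
  obtain ⟨x, hx, y, hy, hxy⟩ := hind
  by_cases hs : ∀ a ∈ K, ¬ G.Adj x a → ¬ G.Adj y a
  · exact main x hx y hy hxy hs
  -- The non-neighbourhoods of x and y in K are nested; otherwise x, y, a, b would be a square.
  refine main y hy x hx hxy.symm fun b hb hyb hxb => ?_
  push Not at hs
  obtain ⟨a, ha, hxa, hya⟩ := hs
  have hab : a ≠ b := fun e => hyb (e ▸ hya)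
  have := h.no_square hxy hya (hKadj a ha b hb hab) hxb.symm (fun e => hx (e ▸ ha))
    (fun e => hy (e ▸ hb))
  tauto

/-- A neighbour of p must meet the edge opposite p, lest a matching appear; a common neighbour of
two non-adjacent pentagon vertices is adjacent to the vertex between them, lest a square appear.
These two rules propagate around the pentagon. -/
theorem SquareFree.adj_pentagon {V : Type*} {G : SimpleGraph V} (h : SquareFree G)
    {x y u z w v : V} (hxy : G.Adj x y) (hyu : G.Adj y u) (huz : G.Adj u z) (hzw : G.Adj z w)
    (hwx : G.Adj w x) (hxu : Gᶜ.Adj x u) (hyz : Gᶜ.Adj y z) (huw : Gᶜ.Adj u w)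
    (hzx : Gᶜ.Adj z x) (hwy : Gᶜ.Adj w y)
    (hvx : v ≠ x) (hvy : v ≠ y) (hvu : v ≠ u) (hvz : v ≠ z) (hvw : v ≠ w)
    (hv : G.Adj v x ∨ G.Adj v y ∨ G.Adj v u ∨ G.Adj v z ∨ G.Adj v w) :
    G.Adj v x ∧ G.Adj v y ∧ G.Adj v u ∧ G.Adj v z ∧ G.Adj v w := by
  have close : ∀ {p q r}, Gᶜ.Adj p q → v ≠ r → G.Adj p r → G.Adj r q → G.Adj v p → G.Adj v q →
      G.Adj v r := fun {p q r} hpq hvr hpr hrq hvp hvq =>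
    (h.no_square hvp hpr hrq hvq.symm hvr hpq.ne).resolve_right ((compl_adj ..).1 hpq).2
  have spread : ∀ {p c d}, v ≠ c → v ≠ d → Gᶜ.Adj p c → Gᶜ.Adj p d → G.Adj c d → G.Adj v p →
      G.Adj v c ∨ G.Adj v d := fun {p c d} hvc hvd hpc hpd hcd hvp => by
    have := h.no_matching hvp hcd hvc hvd hpc.ne hpd.ne
    have := ((compl_adj ..).1 hpc).2
    have := ((compl_adj ..).1 hpd).2
    tauto
  have c1 := close hxu hvy hxy hyu
  have c2 := close hyz hvu hyu huz
  have c3 := close huw hvz huz hzw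
  have c4 := close hzx hvw hzw hwx
  have c5 := close hwy hvx hwx hxy
  have s1 := spread hvu hvz hxu hzx.symm huz
  have s2 := spread hvz hvw hyz hwy.symm hzw
  have s3 := spread hvw hvx huw hxu.symm hwx
  have s4 := spread hvx hvy hzx hyz.symm hxy
  have s5 := spread hvy hvu hwy huw.symm hyu
  clear close spread h
  grind

open Classical in
/-- If in a graph on `n ≠ 0, 5` vertices all degrees and codegrees exceed `n / 4`, then the graph
or its complement contains an induced 4-cycle. -/
theorem exists_inducedSquare {V : Type*} [Fintype V] [Nonempty V] (G : SimpleGraph V)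
    (hcard : Fintype.card V ≠ 5)
    (hdeg : ∀ v, Fintype.card V < 4 * #{u | G.Adj v u})
    (hcodeg : ∀ v, Fintype.card V < 4 * #{u | Gᶜ.Adj v u}) :
    ∃ a b c d, InducedSquare G a b c d ∨ InducedSquare Gᶜ a b c d := by
  by_contra hcon
  push Not at hcon
  have h : SquareFree G := hcon
  suffices hsplit : ∃ A B : Finset V, Disjoint A B ∧ (A ∪ B).Nonempty ∧
      (∀ a ∈ A, ∀ v, v ≠ a → ¬ G.Adj a v → v ∈ B) ∧ (∀ b ∈ B, ∀ v, G.Adj b v → v ∈ A) by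
    obtain ⟨A, B, hAB, hne, hA, hB⟩ := hsplit
    obtain ⟨v, hv | hv⟩ := exists_small_degree_of_split G A B hAB hne hA hB
    · exact absurd hv (hdeg v).not_ge
    · exact absurd hv (hcodeg v).not_ge
  obtain ⟨K, hK, hI⟩ | ⟨x, y, u, z, w, hxy, hyu, huz, hzw, hwx, hxu, hyz, huw, hzx, hwy⟩ :=
    h.split_or_pentagon
  · refine ⟨K, Kᶜ, disjoint_compl_right, by simp [union_compl], ?_, ?_⟩
    · intro a ha v hva hn
      rw [mem_compl]
      exact fun hv => hn (hK a ha v hv hva.symm)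
    · intro b hb v hbv
      by_contra hv
      exact hI b (mem_compl.1 hb) v hv hbv
  set P : Finset V := {x, y, u, z, w} with hP
  have hout : ∀ v ∉ P, v ≠ x ∧ v ≠ y ∧ v ≠ u ∧ v ≠ z ∧ v ≠ w := by
    intro v hv
    simpa [hP, not_or] using hv
  have hall : ∀ v ∉ P, (∃ p ∈ P, G.Adj v p) → ∀ p ∈ P, G.Adj v p := by
    intro v hv hex
    obtain ⟨h1, h2, h3, h4, h5⟩ := hout v hv
    have := h.adj_pentagon hxy hyu huz hzw hwx hxu hyz huw hzx hwy h1 h2 h3 h4 h5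
      (by simpa [hP] using hex)
    simpa [hP] using this
  have hx : x ∈ P := by simp [hP]
  have hy : y ∈ P := by simp [hP]
  have hu : u ∈ P := by simp [hP]
  -- By `hall`, the pentagon is complete to the first set and anticomplete to the second. A non-edge
  -- in the first set makes a square with x, u; an edge in the second makes a matching with xy.
  refine ⟨univ.filter fun v => v ∉ P ∧ G.Adj v x, univ.filter fun v => v ∉ P ∧ ¬ G.Adj v x,
    ?_, ?_, ?_, ?_⟩
  · rw [Finset.disjoint_left]
    intro v hv hv'
    simp only [mem_filter, mem_univ, true_and] at hv hv'
    exact hv'.2 hv.2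
  · by_contra hempty
    rw [not_nonempty_iff_eq_empty] at hempty
    have hPuniv : P = univ := by
      refine eq_univ_of_forall fun v => ?_
      by_contra hv
      have : v ∉ (∅ : Finset V) := notMem_empty v
      rw [← hempty] at this
      simp only [mem_union, mem_filter, mem_univ, true_and] at this
      tauto
    apply hcard
    rw [← card_univ, ← hPuniv, hP]
    have := hxy.ne; have := hyu.ne; have := huz.ne; have := hzw.ne; have := hwx.ne'
    have := hxu.ne; have := hyz.ne; have := huw.ne; have := hzx.ne'; have := hwy.ne'
    rw [card_insert_of_notMem, card_insert_of_notMem, card_insert_of_notMem,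
      card_insert_of_notMem, card_singleton] <;> simp [*]
  · simp only [mem_filter, mem_univ, true_and]
    rintro a ⟨ha, hax⟩ v hva hn
    have haP := hall a ha ⟨x, hx, hax⟩
    have hv : v ∉ P := fun hv => hn (haP v hv)
    refine ⟨hv, fun hvx => ?_⟩
    have hvP := hall v hv ⟨x, hx, hvx⟩
    have := h.no_square hax hvx.symm (hvP u hu) (haP u hu).symm hva.symm hxu.ne
    exact this.elim hn ((compl_adj ..).1 hxu).2
  · simp only [mem_filter, mem_univ, true_and]
    rintro b ⟨hb, hbx⟩ v hbv
    have hbP : ∀ p ∈ P, ¬ G.Adj b p := fun p hp hbp => hbx (hall b hb ⟨p, hp, hbp⟩ x hx)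
    have hv : v ∉ P := fun hv => hbP v hv hbv
    refine ⟨hv, ?_⟩
    by_contra hvx
    have hvP : ∀ p ∈ P, ¬ G.Adj v p := fun p hp hvp => hvx (hall v hv ⟨p, hp, hvp⟩ x hx)
    have ne : ∀ {q p}, q ∉ P → p ∈ P → q ≠ p := fun hq hp e => hq (e ▸ hp)
    have := h.no_matching hbv hxy (ne hb hx) (ne hb hy) (ne hv hx) (ne hv hy)
    have := hbP x hx
    have := hbP y hy
    have := hvP x hx
    have := hvP y hy
    tauto

/-! ### Random samples: concentration and counting of squares. -/

open Classical in
theorem card_filter_comp_mem_le {V : Type*} [Fintype V] {k s : ℕ}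
    (e : Fin k ↪ Fin s) (Q : Finset (Fin k → V)) :
    #{f : Fin s → V | f ∘ e ∈ Q} ≤ #Q * Fintype.card V ^ (s - k) := by
  have hfib : ∀ q : Fin k → V, #{f : Fin s → V | f ∘ e = q} ≤
      Fintype.card V ^ (s - k) := by
    intro q
    let t : Fin s → Finset V := fun j => {v | ∀ l, e l = j → v = q l}
    calc #{f : Fin s → V | f ∘ e = q} ≤ #(Fintype.piFinset t) := by
          apply card_le_card
          intro f hf
          simp only [mem_filter, mem_univ, true_and] at hf
          simp only [Fintype.mem_piFinset, t, mem_filter, mem_univ, true_and]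
          rintro _ l rfl
          exact congrFun hf l
      _ = ∏ j, #(t j) := Fintype.card_piFinset t
      _ ≤ ∏ j, if j ∈ univ.map e then 1 else Fintype.card V := by
          refine prod_le_prod' fun j _ => ?_
          split_ifs with hj
          · obtain ⟨l, -, rfl⟩ := mem_map.1 hj
            refine card_le_one.2 fun a ha b hb => ?_
            simp only [t, mem_filter, mem_univ, true_and] at ha hb
            rw [ha l rfl, hb l rfl]
          · exact card_le_univ _
      _ = Fintype.card V ^ (s - k) := by
          rw [prod_ite, prod_const_one, one_mul, prod_const, filter_notMem_eq_sdiff,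
            card_sdiff_of_subset (subset_univ _), card_map, card_univ, card_univ,
            Fintype.card_fin, Fintype.card_fin]
  calc #{f : Fin s → V | f ∘ e ∈ Q} ≤ #(Q.biUnion fun q => {f : Fin s → V | f ∘ e = q}) := by
        apply card_le_card
        intro f hf
        simpa using hf
    _ ≤ #Q * _ := card_biUnion_le_card_mul _ _ _ fun q _ => hfib q

open Classical in
/-- Chernoff bound: few maps `f` send `i` to `v` and at most a quarter of all points to
neighbours of `v`. -/
theorem card_few_neighbours_at_le {V : Type*} [Fintype V] (H : SimpleGraph V) {ε : ℝ}
    (hε : 0 < ε) (hε4 : ε ≤ 1 / 4) (v : V)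
    (hdeg : (1 / 4 + ε) * Fintype.card V ≤ #{u | H.Adj v u}) {s : ℕ} (i : Fin s) :
    (#{f : Fin s → V | f i = v ∧ 4 * #{j | H.Adj v (f j)} ≤ s} : ℝ) ≤
      (Fintype.card V : ℝ) ^ (s - 1) * Real.exp (1 / 8 - ε ^ 2 * s / 2) := by
  obtain ⟨m, rfl⟩ : ∃ m, s = m + 1 := ⟨s - 1, by have := i.pos; omega⟩
  set n : ℝ := (Fintype.card V : ℝ) with hn
  -- Exponential moment method with parameter ε, the weight being 1 off the neighbourhood of v.
  let w : V → ℝ := fun u => if H.Adj v u then Real.exp (-ε) else 1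
  have hw : ∀ u, 0 ≤ w u := fun u => by
    simp only [w]; split_ifs <;> positivity
  let t : Fin (m + 1) → Finset V := fun j => if j = i then {v} else univ
  have hprod : ∀ f : Fin (m + 1) → V,
      ∏ j, w (f j) = Real.exp (-(ε * #{j | H.Adj v (f j)})) := by
    intro f
    simp only [w]
    rw [prod_ite, prod_const_one, mul_one, prod_const, ← Real.exp_nat_mul]
    ring_nf
  have hn0 : 0 ≤ n := Nat.cast_nonneg _
  have hexp : Real.exp (-ε) ≤ 1 - ε + ε ^ 2 := by
    have := (abs_le.1 (Real.abs_exp_sub_one_sub_id_le (x := -ε)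
      (by rw [abs_neg, abs_of_pos hε]; linarith))).2
    nlinarith
  have hW : ∑ u, w u ≤ n * Real.exp (-(1 / 4 + ε / 2) * ε) := by
    have h1 : ∑ u, w u = n - #{u | H.Adj v u} * (1 - Real.exp (-ε)) := by
      have h2 : ∀ u, w u = 1 - if H.Adj v u then 1 - Real.exp (-ε) else 0 := fun u => by
        simp only [w]; split_ifs <;> ring
      simp only [h2, sum_sub_distrib, sum_const, card_univ, nsmul_eq_mul, mul_one, hn]
      rw [← sum_filter, sum_const, nsmul_eq_mul]
    have h3 : 1 - (1 / 4 + ε / 2) * ε ≤ Real.exp (-(1 / 4 + ε / 2) * ε) := by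
      have := Real.add_one_le_exp (-(1 / 4 + ε / 2) * ε)
      linarith
    have h4 : (1 / 4 + ε) * n * (ε - ε ^ 2) ≤ #{u | H.Adj v u} * (1 - Real.exp (-ε)) :=
      mul_le_mul hdeg (by linarith) (by nlinarith) (by positivity)
    have h5 : (1 / 4 + ε / 2) * ε ≤ (1 / 4 + ε) * (ε - ε ^ 2) := by
      nlinarith [mul_pos hε hε, mul_nonneg (mul_pos hε hε).le (sub_nonneg.2 hε4)]
    have h6 := mul_le_mul_of_nonneg_left h5 hn0
    have h7 := mul_le_mul_of_nonneg_left h3 hn0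
    linarith
  have hsum : ∑ f ∈ Fintype.piFinset t, ∏ j, w (f j) = (∑ u, w u) ^ m := by
    rw [← prod_univ_sum t fun _ => w, ← mul_prod_erase univ _ (mem_univ i)]
    have h1 : ∑ u ∈ t i, w u = 1 := by simp [t, w]
    rw [h1, one_mul, prod_congr rfl (g := fun _ => ∑ u, w u), prod_const]
    · simp
    · intro j hj
      simp [t, ne_of_mem_erase hj]
  calc (#{f : Fin (m + 1) → V | f i = v ∧ 4 * #{j | H.Adj v (f j)} ≤ m + 1} : ℝ)
      = ∑ f : Fin (m + 1) → V with f i = v ∧ 4 * #{j | H.Adj v (f j)} ≤ m + 1, (1 : ℝ) := by simp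
    _ ≤ ∑ f : Fin (m + 1) → V with f i = v ∧ 4 * #{j | H.Adj v (f j)} ≤ m + 1,
          Real.exp (ε * (m + 1) / 4) * ∏ j, w (f j) := by
        refine sum_le_sum fun f hf => ?_
        simp only [mem_filter, mem_univ, true_and] at hf
        rw [hprod, ← Real.exp_add]
        apply Real.one_le_exp
        have : (4 * #{j | H.Adj v (f j)} : ℝ) ≤ m + 1 := by exact_mod_cast hf.2
        nlinarith
    _ ≤ ∑ f ∈ Fintype.piFinset t, Real.exp (ε * (m + 1) / 4) * ∏ j, w (f j) := by
        refine sum_le_sum_of_subset_of_nonneg ?_ fun f _ _ =>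
          mul_nonneg (Real.exp_nonneg _) (prod_nonneg fun j _ => hw _)
        intro f hf
        simp only [mem_filter, mem_univ, true_and] at hf
        rw [Fintype.mem_piFinset]
        intro j
        by_cases hj : j = i
        · subst hj; simp [t, hf.1]
        · simp [t, hj]
    _ = Real.exp (ε * (m + 1) / 4) * (∑ u, w u) ^ m := by rw [← mul_sum, hsum]
    _ ≤ Real.exp (ε * (m + 1) / 4) * (n * Real.exp (-(1 / 4 + ε / 2) * ε)) ^ m := by
        gcongr
    _ = n ^ m * Real.exp (ε * (m + 1) / 4 + m * (-(1 / 4 + ε / 2) * ε)) := by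
        rw [mul_pow, ← Real.exp_nat_mul, Real.exp_add]; ring
    -- Only m coordinates are random; the 1/8 absorbs the loss ε/4 + ε²/2 from the fixed one.
    _ ≤ n ^ (m + 1 - 1) * Real.exp (1 / 8 - ε ^ 2 * (m + 1 : ℕ) / 2) := by
        rw [Nat.add_sub_cancel]
        gcongr
        push_cast
        nlinarith

-- Union bound over the position i and its image v; the n choices of v restore the fixed coordinate.
-- With x = ε²s/2, the bound exp x ≥ x²/2 = ε⁴s²/8 ≥ 64s beats the factor s, hence s of order ε⁻⁴.
open Classical in
theorem card_few_neighbours_le {V : Type*} [Fintype V] [Nonempty V] (H : SimpleGraph V) {ε : ℝ}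
    (hε : 0 < ε) (hε4 : ε ≤ 1 / 4)
    (hdeg : ∀ v, (1 / 4 + ε) * Fintype.card V ≤ #{u | H.Adj v u}) {s : ℕ}
    (hs : 512 ≤ ε ^ 4 * s) :
    (#{f : Fin s → V | ∃ i, 4 * #{j | H.Adj (f i) (f j)} ≤ s} : ℝ) ≤
      (Fintype.card V : ℝ) ^ s / 8 := by
  have hs0 : (0 : ℝ) < s := by
    by_contra hcon
    have : ε ^ 4 * s ≤ 0 := mul_nonpos_of_nonneg_of_nonpos (by positivity) (not_lt.1 hcon)
    linarith
  have hexp : s * Real.exp (1 / 8 - ε ^ 2 * s / 2) ≤ 1 / 8 := by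
    have h1 : Real.exp (1 / 8) ≤ 2 := by
      have := (abs_le.1 (Real.abs_exp_sub_one_sub_id_le (x := 1 / 8)
        (by rw [abs_of_pos] <;> norm_num))).2
      linarith
    have h2 := Real.quadratic_le_exp_of_nonneg (x := ε ^ 2 * s / 2) (by positivity)
    have h3 : 16 * (s : ℝ) ≤ Real.exp (ε ^ 2 * s / 2) := by
      have : (0 : ℝ) ≤ ε ^ 2 * s / 2 := by positivity
      nlinarith [mul_le_mul_of_nonneg_right hs hs0.le]
    rw [Real.exp_sub, mul_div_assoc', div_le_iff₀ (Real.exp_pos _)]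
    nlinarith
  have hn : (Fintype.card V : ℝ) * (Fintype.card V : ℝ) ^ (s - 1) = (Fintype.card V : ℝ) ^ s := by
    rw [← pow_succ']
    congr 1
    have : 0 < s := by exact_mod_cast hs0
    omega
  calc (#{f : Fin s → V | ∃ i, 4 * #{j | H.Adj (f i) (f j)} ≤ s} : ℝ)
      ≤ ∑ p : Fin s × V, (#{f : Fin s → V | f p.1 = p.2 ∧ 4 * #{j | H.Adj p.2 (f j)} ≤ s} : ℝ) := by
        rw [← Nat.cast_sum]
        refine Nat.cast_le.2 ((card_le_card ?_).trans card_biUnion_le)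
        intro f hf
        simp only [mem_filter, mem_univ, true_and] at hf
        obtain ⟨i, hi⟩ := hf
        simp only [mem_biUnion, mem_filter, mem_univ, true_and]
        exact ⟨(i, f i), rfl, hi⟩
    _ ≤ ∑ p : Fin s × V, (Fintype.card V : ℝ) ^ (s - 1) * Real.exp (1 / 8 - ε ^ 2 * s / 2) :=
        sum_le_sum fun p _ => card_few_neighbours_at_le H hε hε4 p.2 (hdeg p.2) p.1
    _ = (Fintype.card V * (Fintype.card V : ℝ) ^ (s - 1)) *
          (s * Real.exp (1 / 8 - ε ^ 2 * s / 2)) := by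
        simp; ring
    _ ≤ (Fintype.card V : ℝ) ^ s / 8 := by
        rw [hn]
        have : (0 : ℝ) ≤ (Fintype.card V : ℝ) ^ s := by positivity
        nlinarith

/-- The 4-tuples inducing a 4-cycle of `G`. -/
def squares {V : Type*} (G : SimpleGraph V) : Set (Fin 4 → V) :=
  {q | InducedSquare G (q 0) (q 1) (q 2) (q 3)}

/-- Injectivity matters: distinct points with equal image are adjacent in the complement of the
pullback but not in the pullback of the complement. -/
theorem compl_comap_of_injective {V W : Type*} (G : SimpleGraph V) {f : W → V}
    (hf : f.Injective) : (G.comap f)ᶜ = Gᶜ.comap f := by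
  ext a b
  simp [hf.ne_iff]

theorem InducedSquare.injective {V : Type*} {G : SimpleGraph V} {q : Fin 4 → V}
    (h : q ∈ squares G) : q.Injective := by
  obtain ⟨h1, h2, h3, h4, h5, h6⟩ := h
  have := h1.ne; have := h2.ne; have := h3.ne; have := h4.ne; have := h5.ne; have := h6.ne
  intro i j hij
  fin_cases i <;> fin_cases j <;> simp_all

-- Low degree, low codegree and non-injectivity spoil at most 1/8 + 1/8 + 1/4 of all maps. Each
-- remaining map has a square at one of at most s⁴ positions, and each square at a given position
-- extends to at most n^(s-4) maps.
open Classical in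
theorem card_squares_ge {V : Type*} [Fintype V] [Nonempty V] (G : SimpleGraph V) {ε : ℝ}
    (hε : 0 < ε) (hε4 : ε ≤ 1 / 4)
    (hdeg : ∀ v, (1 / 4 + ε) * Fintype.card V ≤ #{u | G.Adj v u})
    (hcodeg : ∀ v, (1 / 4 + ε) * Fintype.card V ≤ #{u | Gᶜ.Adj v u}) {s : ℕ}
    (hs : 512 ≤ ε ^ 4 * s) (hsn : 4 * s ^ 2 ≤ Fintype.card V) :
    (Fintype.card V : ℝ) ^ 4 ≤
      2 * s ^ 4 * (#(squares G).toFinset + #(squares Gᶜ).toFinset) := by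
  set n := Fintype.card V with hn
  have hs512 : 512 ≤ s := by
    have h1 : ε ^ 4 ≤ 1 := pow_le_one₀ hε.le (by linarith)
    have : (512 : ℝ) ≤ s := hs.trans (by nlinarith [(Nat.cast_nonneg s : (0 : ℝ) ≤ s)])
    exact_mod_cast this
  have hn0 : (0 : ℝ) < n := by exact_mod_cast Fintype.card_pos
  have : Nonempty (Fin s) := ⟨⟨0, by omega⟩⟩
  set Q := (squares G).toFinset ∪ (squares Gᶜ).toFinset with hQ
  set D : Finset (Fin 2 → V) := univ.image fun v _ => v with hD
  have hDcard : #D ≤ n := card_image_le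
  let B₁ : Finset (Fin s → V) := {f | ∃ i, 4 * #{j | G.Adj (f i) (f j)} ≤ s}
  let B₂ : Finset (Fin s → V) := {f | ∃ i, 4 * #{j | Gᶜ.Adj (f i) (f j)} ≤ s}
  let B₃ : Finset (Fin s → V) := univ.biUnion fun e : Fin 2 ↪ Fin s => {f | f ∘ e ∈ D}
  let B₄ : Finset (Fin s → V) := univ.biUnion fun e : Fin 4 ↪ Fin s => {f | f ∘ e ∈ Q}
  have hcover : (univ : Finset (Fin s → V)) ⊆ B₁ ∪ B₂ ∪ B₃ ∪ B₄ := by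
    intro f _
    by_contra hf
    simp only [mem_union, not_or] at hf
    obtain ⟨⟨⟨h1, h2⟩, h3⟩, h4⟩ := hf
    have hinj : f.Injective := by
      intro a b hab
      by_contra hne
      refine h3 (mem_biUnion.2 ⟨⟨![a, b], ?_⟩, mem_univ _, ?_⟩)
      · intro i j hij
        fin_cases i <;> fin_cases j <;> simp_all [eq_comm]
      · simp only [mem_filter, mem_univ, true_and, hD, mem_image]
        refine ⟨f a, ?_⟩
        ext i
        fin_cases i
        · rfl
        · exact congrArg id hab
    simp only [B₁, B₂, mem_filter, mem_univ, true_and, not_exists, not_le] at h1 h2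
    obtain ⟨a, b, c, d, hsq⟩ := exists_inducedSquare (G.comap f) (by simp; omega)
      (by simpa using h1)
      (fun v => by
        have hadj : ∀ u, (G.comap f)ᶜ.Adj v u ↔ Gᶜ.Adj (f v) (f u) := fun u => by
          rw [compl_comap_of_injective G hinj, comap_adj]
        simpa only [hadj, Fintype.card_fin] using h2 v)
    rw [compl_comap_of_injective G hinj] at hsq
    have hq : (![a, b, c, d] : Fin 4 → Fin s).Injective ∧ f ∘ ![a, b, c, d] ∈ Q := by
      have key : ∀ H : SimpleGraph V, InducedSquare (H.comap f) a b c d →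
          (![a, b, c, d] : Fin 4 → Fin s).Injective ∧ f ∘ ![a, b, c, d] ∈ squares H := by
        intro H hH
        refine ⟨InducedSquare.injective (G := H.comap f) hH, ?_⟩
        rw [InducedSquare, compl_comap_of_injective H hinj] at hH
        exact hH
      rcases hsq with hsq | hsq
      · exact ⟨(key G hsq).1, by simpa [hQ] using Or.inl (key G hsq).2⟩
      · exact ⟨(key Gᶜ hsq).1, by simpa [hQ] using Or.inr (key Gᶜ hsq).2⟩
    exact h4 (mem_biUnion.2 ⟨⟨_, hq.1⟩, mem_univ _, by simpa using hq.2⟩)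
  have hemb : ∀ k, Fintype.card (Fin k ↪ Fin s) ≤ s ^ k := fun k => by
    rw [Fintype.card_embedding_eq]
    simpa using Nat.descFactorial_le_pow s k
  have hB₃ : #B₃ ≤ s ^ 2 * (n * n ^ (s - 2)) := by
    refine (card_biUnion_le_card_mul _ _ (n * n ^ (s - 2)) fun e _ => ?_).trans
      (Nat.mul_le_mul_right _ (hemb 2))
    refine (card_filter_comp_mem_le e D).trans ?_
    gcongr
  have hB₄ : #B₄ ≤ s ^ 4 * (#Q * n ^ (s - 4)) := by
    refine (card_biUnion_le_card_mul _ _ (#Q * n ^ (s - 4)) fun e _ => ?_).trans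
      (Nat.mul_le_mul_right _ (hemb 4))
    exact card_filter_comp_mem_le e Q
  have hB₁ : (#B₁ : ℝ) ≤ (n : ℝ) ^ s / 8 := card_few_neighbours_le G hε hε4 hdeg hs
  have hB₂ : (#B₂ : ℝ) ≤ (n : ℝ) ^ s / 8 := by
    convert card_few_neighbours_le Gᶜ hε hε4 (fun v => by convert hcodeg v) hs
  have htotal : (n : ℝ) ^ s ≤ #B₁ + #B₂ + #B₃ + #B₄ := by
    have h1 := card_le_card hcover
    have h2 := card_union_le (B₁ ∪ B₂ ∪ B₃) B₄
    have h3 := card_union_le (B₁ ∪ B₂) B₃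
    have h4 := card_union_le B₁ B₂
    rw [card_univ, Fintype.card_fun, Fintype.card_fin, ← hn] at h1
    exact_mod_cast (by omega : n ^ s ≤ #B₁ + #B₂ + #B₃ + #B₄)
  have hB₃' : (#B₃ : ℝ) ≤ (n : ℝ) ^ s / 4 := by
    have h1 : (#B₃ : ℝ) ≤ s ^ 2 * (n * n ^ (s - 2)) := by exact_mod_cast hB₃
    have h2 : (4 * s ^ 2 : ℝ) ≤ n := by exact_mod_cast hsn
    have h3 : (n : ℝ) ^ s = n * (n * n ^ (s - 2)) := by
      rw [← pow_succ', ← pow_succ']; congr 1; omega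
    rw [h3]
    have h4 : (0 : ℝ) ≤ n * n ^ (s - 2) := by positivity
    nlinarith
  have hB₄' : (#B₄ : ℝ) ≤ s ^ 4 * (#Q * n ^ (s - 4)) := by exact_mod_cast hB₄
  have hsplit : (n : ℝ) ^ s = n ^ 4 * n ^ (s - 4) := by
    rw [← pow_add]; congr 1; omega
  have hfin : (n : ℝ) ^ 4 * n ^ (s - 4) ≤ (2 * s ^ 4 * #Q) * n ^ (s - 4) := by
    rw [← hsplit]; linarith
  have hle := le_of_mul_le_mul_right hfin (by positivity)
  have hQcard : (#Q : ℝ) ≤ #(squares G).toFinset + #(squares Gᶜ).toFinset := by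
    exact_mod_cast card_union_le _ _
  exact hle.trans (by gcongr)

/-! ### From squares to coloured copies. -/

theorem labelGraph_zero_eq_compl {V : Type*} (c : TopEdgeLabeling V (Fin 2)) :
    c.labelGraph 0 = (c.labelGraph 1)ᶜ := by
  ext a b
  simp only [TopEdgeLabeling.labelGraph_adj, compl_adj, not_exists]
  constructor
  · rintro ⟨h, h0⟩
    exact ⟨h, fun _ => by simp [h0]⟩
  · rintro ⟨h, h0⟩
    exact ⟨h, by have := h0 h; omega⟩

theorem adj_of_mem_squares {V : Type*} {G : SimpleGraph V} {q : Fin 4 → V}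
    (hq : q ∈ squares G) (i j : Fin 4) (hij : i ≠ j) :
    if i - j = 1 ∨ j - i = 1 then G.Adj (q i) (q j) else Gᶜ.Adj (q i) (q j) := by
  obtain ⟨h1, h2, h3, h4, h5, h6⟩ := hq
  have := h1.symm; have := h2.symm; have := h3.symm; have := h4.symm
  have := h5.symm; have := h6.symm
  fin_cases i <;> fin_cases j <;> first | exact absurd rfl hij | assumption

theorem image_mem_copies_C4 {V : Type*} [DecidableEq V] (c : TopEdgeLabeling V (Fin 2))
    {q : Fin 4 → V} (hq : q ∈ squares (c.labelGraph 1)) : univ.image q ∈ copies C4 c := by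
  refine ⟨⟨q, InducedSquare.injective hq⟩, by rw [map_eq_image]; rfl, ?_⟩
  refine EdgeLabeling.ext_get fun i j hij => ?_
  have h := adj_of_mem_squares hq i j hij
  rw [← labelGraph_zero_eq_compl] at h
  change c.get (q i) (q j) _ = if i - j = 1 ∨ j - i = 1 then 1 else 0
  split_ifs at h ⊢
  · exact ((TopEdgeLabeling.labelGraph_adj _ _).1 h).2
  · exact ((TopEdgeLabeling.labelGraph_adj _ _).1 h).2

theorem image_mem_copies_swapColours_C4 {V : Type*} [DecidableEq V]
    (c : TopEdgeLabeling V (Fin 2)) {q : Fin 4 → V} (hq : q ∈ squares (c.labelGraph 1)ᶜ) :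
    univ.image q ∈ copies (swapColours C4) c := by
  refine ⟨⟨q, InducedSquare.injective hq⟩, by rw [map_eq_image]; rfl, ?_⟩
  refine EdgeLabeling.ext_get fun i j hij => ?_
  have h := adj_of_mem_squares hq i j hij
  rw [compl_compl, ← labelGraph_zero_eq_compl] at h
  change c.get (q i) (q j) _ = Equiv.swap 0 1 (if i - j = 1 ∨ j - i = 1 then 1 else 0)
  split_ifs at h ⊢
  · exact ((TopEdgeLabeling.labelGraph_adj _ _).1 h).2
  · exact ((TopEdgeLabeling.labelGraph_adj _ _).1 h).2

open Classical in
theorem card_tuples_le {V : Type*} [Fintype V] (T : Finset (Fin 4 → V)) (F : Set (Finset V))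
    (h : ∀ q ∈ T, univ.image q ∈ F) : #T ≤ 256 * F.ncard := by
  have h1 : #T ≤ 256 * #(T.image fun q => univ.image q) := by
    refine card_le_mul_card_image T 256 fun S hS => ?_
    obtain ⟨p, -, rfl⟩ := mem_image.1 hS
    calc #{q ∈ T | univ.image q = univ.image p}
        ≤ #(Fintype.piFinset fun _ : Fin 4 => univ.image p) := by
          apply card_le_card
          intro q hq
          rw [Fintype.mem_piFinset]
          intro i
          rw [← (mem_filter.1 hq).2]
          exact mem_image_of_mem q (mem_univ i)
      _ = #(univ.image p) ^ 4 := by simp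
      _ ≤ 4 ^ 4 := by
          gcongr
          simpa using card_image_le (s := univ) (f := p)
      _ = 256 := by norm_num
  refine h1.trans (Nat.mul_le_mul_left _ ?_)
  rw [← Set.ncard_coe_finset]
  refine Set.ncard_le_ncard ?_ (Set.toFinite F)
  intro S hS
  obtain ⟨q, hq, rfl⟩ := mem_image.1 (mem_coe.1 hS)
  exact h q hq

open Classical in
/-- Polynomial lower bound for the number of copies, in terms of a sample size `s`. -/
theorem pow_four_le_mul_copies {V : Type*} [Fintype V] [DecidableEq V] [Nonempty V]
    (c : TopEdgeLabeling V (Fin 2)) (hV : Fintype.card V ≠ 5) {ε : ℝ}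
    (hε : 0 < ε) (hε4 : ε ≤ 1 / 4)
    (hdeg : ∀ v, (1 / 4 + ε) * Fintype.card V ≤ #{u | (c.labelGraph 1).Adj v u})
    (hcodeg : ∀ v, (1 / 4 + ε) * Fintype.card V ≤ #{u | (c.labelGraph 1)ᶜ.Adj v u}) {s : ℕ}
    (hs : 512 ≤ ε ^ 4 * s) :
    (Fintype.card V : ℝ) ^ 4 ≤
      512 * s ^ 8 * ((copies C4 c).ncard + (copies (swapColours C4) c).ncard) := by
  set G := c.labelGraph 1
  have hs1 : (1 : ℝ) ≤ s := by
    have h1 : ε ^ 4 ≤ 1 := pow_le_one₀ hε.le (by linarith)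
    nlinarith [(Nat.cast_nonneg s : (0 : ℝ) ≤ s)]
  -- For n < 4s², one copy is enough since n⁴ ≤ 256s⁸; this case sets the exponent 8 and is where n
  -- ≠ 5 matters.
  rcases le_or_gt (4 * s ^ 2) (Fintype.card V) with hsn | hsn
  · have h1 := card_squares_ge G hε hε4 (fun v => by convert hdeg v)
      (fun v => by convert hcodeg v) hs hsn
    have h2 : (#(squares G).toFinset : ℝ) ≤ 256 * (copies C4 c).ncard := by
      exact_mod_cast card_tuples_le _ _ fun q hq => by
        convert image_mem_copies_C4 c (Set.mem_toFinset.1 hq)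
    have h3 : (#(squares Gᶜ).toFinset : ℝ) ≤ 256 * (copies (swapColours C4) c).ncard := by
      exact_mod_cast card_tuples_le _ _ fun q hq => by
        convert image_mem_copies_swapColours_C4 c (Set.mem_toFinset.1 hq)
    calc (Fintype.card V : ℝ) ^ 4
        ≤ 2 * s ^ 4 * (#(squares G).toFinset + #(squares Gᶜ).toFinset) := h1
      _ ≤ 2 * s ^ 8 * (256 * (copies C4 c).ncard + 256 * (copies (swapColours C4) c).ncard) := by
          gcongr
          norm_num
      _ = _ := by ring
  · have hn0 : (0 : ℝ) < Fintype.card V := by exact_mod_cast Fintype.card_pos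
    have quarter : ∀ m : ℕ, (1 / 4 + ε) * Fintype.card V ≤ m → Fintype.card V < 4 * m := by
      intro m hm
      have : (Fintype.card V : ℝ) < 4 * m := by nlinarith
      exact_mod_cast this
    obtain ⟨a, b, x, y, hsq⟩ := exists_inducedSquare G hV (fun v => quarter _ (by convert hdeg v))
      (fun v => quarter _ (by convert hcodeg v))
    have hone : (1 : ℝ) ≤ (copies C4 c).ncard + (copies (swapColours C4) c).ncard := by
      have : 0 < (copies C4 c).ncard + (copies (swapColours C4) c).ncard := by
        rcases hsq with hsq | hsq
        · have := (Set.ncard_pos (Set.toFinite _)).2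
            ⟨_, image_mem_copies_C4 c (q := ![a, b, x, y]) hsq⟩
          omega
        · have := (Set.ncard_pos (Set.toFinite _)).2
            ⟨_, image_mem_copies_swapColours_C4 c (q := ![a, b, x, y]) hsq⟩
          omega
      exact_mod_cast this
    have h1 : (Fintype.card V : ℝ) ≤ 4 * s ^ 2 := by exact_mod_cast hsn.le
    calc (Fintype.card V : ℝ) ^ 4 ≤ (4 * (s : ℝ) ^ 2) ^ 4 := by gcongr
      _ = 256 * (s : ℝ) ^ 8 * 1 := by ring
      _ ≤ _ := by
          gcongr
          norm_num

/-! ### Constants and conclusion. -/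

/-- The second factor is 2⁹⁰ε⁻³². As L = log(1/ε) ≥ 1 and log 2 ≥ 1/2, 32L ≤ 64 L⁸ log 2, and 154 =
90 + 64. -/
theorem quasipolynomial_bound {ε : ℝ} (hε : 0 < ε) (hε4 : ε ≤ 1 / 4) :
    (2 : ℝ) ^ (-154 * Real.log (1 / ε) ^ 8) * (1024 * (1024 / ε ^ 4) ^ 8) ≤ 1 := by
  set L := Real.log (1 / ε) with hL
  have hlog2 : 1 / 2 ≤ Real.log 2 := by linarith [Real.log_two_gt_d9]
  have hεL : 1 / ε = Real.exp L := (Real.exp_log (by positivity)).symm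
  have hL1 : 1 ≤ L := by
    have h4 : Real.log 4 ≤ L := by
      apply Real.log_le_log (by norm_num)
      rw [le_div_iff₀ hε]; linarith
    have : Real.log 4 = 2 * Real.log 2 := by
      rw [show (4 : ℝ) = 2 ^ 2 by norm_num, Real.log_pow]; norm_num
    linarith
  have hL8 : L ≤ L ^ 8 := le_self_pow₀ hL1 (by norm_num)
  have h1 : (1024 * (1024 / ε ^ 4) ^ 8 : ℝ) = Real.exp (90 * Real.log 2 + 32 * L) := by
    rw [Real.exp_add, show (32 * L) = (32 : ℕ) * L by norm_num, Real.exp_nat_mul, ← hεL,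
      show (90 * Real.log 2) = (90 : ℕ) * Real.log 2 by norm_num, Real.exp_nat_mul,
      Real.exp_log (by norm_num)]
    field_simp
    norm_num
  rw [h1, Real.rpow_def_of_pos (by norm_num), ← Real.exp_add, Real.exp_le_one_iff]
  nlinarith [mul_le_mul hlog2 (hL1.trans hL8) (by norm_num) (by linarith),
    mul_le_mul_of_nonneg_left hL8 (by linarith : (0 : ℝ) ≤ Real.log 2),
    mul_le_mul_of_nonneg_left (hL1.trans hL8) (by linarith : (0 : ℝ) ≤ Real.log 2)]

end LocallyBalanced

theorem mainTheorem6 :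
    ∃ C₁ : ℝ, 0 < C₁ ∧
      ∀ (n : ℕ) (ε : ℝ) (c : SimpleGraph.TopEdgeLabeling (Fin n) (Fin 2)),
        n ≠ 5 → 0 < ε → LocallyBalanced.IsLocallyBalanced c (1 / 4 + ε) →
          (2 : ℝ) ^ (-C₁ * Real.log (1 / ε) ^ 8) * (n : ℝ) ^ 4
              ≤ ((LocallyBalanced.copies LocallyBalanced.C4 c).ncard : ℝ) ∨
          (2 : ℝ) ^ (-C₁ * Real.log (1 / ε) ^ 8) * (n : ℝ) ^ 4
              ≤ ((LocallyBalanced.copies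
                  (LocallyBalanced.swapColours LocallyBalanced.C4) c).ncard : ℝ) := by
  classical
  refine ⟨154, by norm_num, fun n ε c hn hε hbal => ?_⟩
  rcases Nat.eq_zero_or_pos n with rfl | hpos
  · left; simp
  have : Nonempty (Fin n) := ⟨⟨0, hpos⟩⟩
  have hn0 : (0 : ℝ) < n := by exact_mod_cast hpos
  have hdeg : ∀ v k, (1 / 4 + ε) * Fintype.card (Fin n) ≤
      (Finset.univ.filter fun u => (c.labelGraph k).Adj v u).card := by
    intro v k
    convert hbal v k
    rw [← SimpleGraph.card_neighborFinset_eq_degree]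
    congr 1
    ext u
    simp
  have hdeg1 := fun v => hdeg v 1
  have hdeg0 := fun v => hdeg v 0
  simp only [LocallyBalanced.labelGraph_zero_eq_compl] at hdeg0
  -- Degree and codegree sum to at most n, so 1/2 + 2ε ≤ 1.
  have hε4 : ε ≤ 1 / 4 := by
    have h1 := hdeg1 ⟨0, hpos⟩
    have h0 := hdeg0 ⟨0, hpos⟩
    have hsum : ((Finset.univ.filter fun u => (c.labelGraph 1).Adj ⟨0, hpos⟩ u).card : ℝ) +
        (Finset.univ.filter fun u => (c.labelGraph 1)ᶜ.Adj ⟨0, hpos⟩ u).card ≤ n := by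
      rw [← Nat.cast_add, ← Finset.card_union_of_disjoint]
      · exact_mod_cast (Finset.card_le_univ _).trans_eq (Fintype.card_fin n)
      · rw [Finset.disjoint_filter]
        intro u _ h h'
        exact ((SimpleGraph.compl_adj ..).1 h').2 h
    rw [Fintype.card_fin] at h1 h0
    by_contra hcon
    nlinarith [mul_pos (sub_pos.2 (not_le.1 hcon)) hn0]
  have hs : 512 ≤ ε ^ 4 * (⌈512 / ε ^ 4⌉₊ : ℝ) := by
    have := Nat.le_ceil (512 / ε ^ 4)
    rwa [div_le_iff₀' (by positivity)] at this
  have hs' : (⌈512 / ε ^ 4⌉₊ : ℝ) ≤ 1024 / ε ^ 4 := by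
    have h1 := (Nat.ceil_lt_add_one (by positivity : 0 ≤ 512 / ε ^ 4)).le
    have h2 : 1 ≤ 512 / ε ^ 4 := by
      rw [le_div_iff₀ (by positivity)]
      have : ε ^ 4 ≤ 1 := pow_le_one₀ hε.le (by linarith)
      linarith
    have h3 : 1024 / ε ^ 4 = 512 / ε ^ 4 + 512 / ε ^ 4 := by ring
    linarith
  have hcount := LocallyBalanced.pow_four_le_mul_copies c (by simpa using hn) hε hε4 hdeg1
    (fun v => by convert hdeg0 v) hs
  rw [Fintype.card_fin] at hcount
  have hq := LocallyBalanced.quasipolynomial_bound hε hε4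
  set δ := (2 : ℝ) ^ (-154 * Real.log (1 / ε) ^ 8)
  set s : ℝ := (⌈512 / ε ^ 4⌉₊ : ℝ)
  have hs0 : 0 < s := by
    by_contra hcon
    have : ε ^ 4 * s ≤ 0 := mul_nonpos_of_nonneg_of_nonpos (by positivity) (not_lt.1 hcon)
    linarith
  have hδ : 0 < δ := by positivity
  -- 1024 = 2 · 512: both kinds of copies falling below δn⁴ would contradict `hcount`.
  have hδs : δ * (1024 * s ^ 8) ≤ 1 := le_trans (by gcongr) hq
  by_contra hcon
  push Not at hcon
  have hlt := mul_lt_mul_of_pos_left (add_lt_add hcon.1 hcon.2)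
    (by positivity : 0 < 512 * s ^ 8)
  have hle := mul_le_mul_of_nonneg_right hδs (by positivity : 0 ≤ (n : ℝ) ^ 4)
  linarith
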